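/- Let $G=K_{3,2}$ be the complete bipartite graph with parts of sizes $3$ and $2$. For a finite graph $H$ on the vertex set $V$ let $k(H)$ be its number of connected components and $r(H)=|V|-k(H)$ its rank. Let $$T(G;x,y)=\sum_{A}(x-1)^{r(G)-r(A)}(y-1)^{|E(A)|-r(A)}$$ be the Tutte polynomial of $G$, where $A$ runs over all spanning subgraphs of $G$ (subgraphs with vertex set $V(G)$ and edge set contained in $E(G)$), and let $T_x$ be its partial derivative in $x$. Then $T\left(G;\frac1t,\frac1{1-t}\right)\ne 0$ for all $0<t<1$, and the integrand of Steele's formula, $$\frac{1-t}{t}\cdot\frac{T_x\left(G;\frac1t,\frac1{1-t}\right)}{T\left(G;\frac1t,\frac1{1-t}\right)}\qquad(0<t<1),$$ is given on $(0,1)$ by a unique real polynomial $p_m(t)$ (where $m=6$ is the number of edges of $G$), namely $$p_m(t)=4-6t+3t^4-t^6 .$$ Moreover, let $(\xi_e)_{e\in E(G)}$ be independent random variables, each uniformly distributed on $[0,1]$, and let $L(G)$ be the total length $\sum_e\xi_e$ of a minimal spanning tree of $G$ with edge lengths $\xi_e$, that is, the minimum of $\sum_{e\in E(T)}\xi_e$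 over all spanning trees $T$ of $G$. Then $L(G)$ is integrable and $$\mathbb E[L(K_{3,2})]=\int_0^1\left(4-6t+3t^4-t^6\right)dt=\frac{51}{35}.$$ -/

import Mathlib

open MeasureTheory ProbabilityTheory

noncomputable section

namespace SpanningTrees

variable {V : Type*} {G : SimpleGraph V}

/-- The spanning subgraph of `G` with vertex set `V` and edge set `A ⊆ E(G)`. The set of all spanning
subgraphs of `G` is thus indexed by `Finset G.edgeSet`. -/
def spanningSubgraph (A : Finset G.edgeSet) : SimpleGraph V :=
  SimpleGraph.fromEdgeSet (Subtype.val '' (A : Set G.edgeSet))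

/-- The number `k(H)` of connected components of a graph `H`. -/
def numComponents (H : SimpleGraph V) : ℕ := Nat.card H.ConnectedComponent

/-- The rank `r(H) = |V(H)| - k(H)`; there is no truncation on a finite vertex set,
see `numComponents_le`. -/
def rank (H : SimpleGraph V) : ℕ := Nat.card V - numComponents H

theorem numComponents_le [Finite V] (H : SimpleGraph V) : numComponents H ≤ Nat.card V :=
  Nat.card_le_card_of_surjective H.connectedComponentMk Quot.mk_surjective

variable (G) in
/-- The Tutte polynomial
`T(G; x, y) = ∑_A (x - 1) ^ (r(G) - r(A)) * (y - 1) ^ (|A| - r(A))`, with `x = X 0`, `y = X 1`,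
summed over all spanning subgraphs `A` of `G`. One has `r(A) ≤ r(G)` and `r(A) ≤ |A|`, so the
exponents are true differences. -/
def tuttePolynomial [Fintype G.edgeSet] : MvPolynomial (Fin 2) ℝ :=
  ∑ A : Finset G.edgeSet,
    (MvPolynomial.X 0 - 1) ^ (rank G - rank (spanningSubgraph A)) *
      (MvPolynomial.X 1 - 1) ^ (A.card - rank (spanningSubgraph A))

variable (G) in
/-- The value `T(G; x, y)`. -/
def tutteEval [Fintype G.edgeSet] (x y : ℝ) : ℝ :=
  MvPolynomial.eval ![x, y] (tuttePolynomial G)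

variable (G) in
/-- The value `T_x(G; x, y)` of the partial derivative of the Tutte polynomial in `x`. -/
def tutteDxEval [Fintype G.edgeSet] (x y : ℝ) : ℝ :=
  MvPolynomial.eval ![x, y] (MvPolynomial.pderiv 0 (tuttePolynomial G))

variable (G) in
/-- The integrand of Steele's formula, a function of `t` in the open interval `(0, 1)`. -/
def steeleIntegrand [Fintype G.edgeSet] (t : ℝ) : ℝ :=
  (1 - t) / t * (tutteDxEval G (1 / t) (1 / (1 - t)) / tutteEval G (1 / t) (1 / (1 - t)))

/-- `A` is the edge set of a spanning tree of `G`. -/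
def IsSpanningTree (A : Finset G.edgeSet) : Prop := (spanningSubgraph A).IsTree

/-- The total length of the edges in `A`. -/
def totalLength (w : G.edgeSet → ℝ) (A : Finset G.edgeSet) : ℝ := ∑ e ∈ A, w e

/-- `A` is the edge set of a minimal spanning tree of `G` for the edge lengths `w`. -/
def IsMinSpanningTree (w : G.edgeSet → ℝ) (A : Finset G.edgeSet) : Prop :=
  IsSpanningTree A ∧ ∀ B : Finset G.edgeSet, IsSpanningTree B → totalLength w A ≤ totalLength w B

variable (G) in
/-- The total length of a minimal spanning tree of `G` for the edge lengths `w`. For a finite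
connected graph the infimum is attained, and it is the length of every minimal spanning tree:
see `exists_isMinSpanningTree` and `IsMinSpanningTree.totalLength_eq`. -/
def mstLength (w : G.edgeSet → ℝ) : ℝ :=
  ⨅ A : {A : Finset G.edgeSet // IsSpanningTree A}, totalLength w A.1

theorem exists_isSpanningTree [Finite V] (hG : G.Connected) :
    ∃ A : Finset G.edgeSet, IsSpanningTree A := by
  classical
  obtain ⟨T, hT, hTree⟩ := hG.exists_isTree_le
  have hfin : {e : G.edgeSet | e.1 ∈ T.edgeSet}.Finite := Set.toFinite _
  refine ⟨hfin.toFinset, ?_⟩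
  have h : (Subtype.val '' (hfin.toFinset : Set G.edgeSet) : Set (Sym2 V)) = T.edgeSet := by
    ext e
    simp only [Set.Finite.coe_toFinset, Set.mem_image, Set.mem_ofPred_eq, Subtype.exists,
      exists_and_left, exists_prop, exists_eq_right_right]
    exact ⟨fun h => h.1, fun h => ⟨h, SimpleGraph.edgeSet_mono hT h⟩⟩
  rw [IsSpanningTree, spanningSubgraph, h, SimpleGraph.fromEdgeSet_edgeSet]
  exact hTree

theorem exists_isMinSpanningTree [Finite V] (hG : G.Connected) (w : G.edgeSet → ℝ) :
    ∃ A : Finset G.edgeSet, IsMinSpanningTree w A := by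
  obtain ⟨A₀, h₀⟩ := exists_isSpanningTree hG
  obtain ⟨A, hA, hmin⟩ := Set.exists_min_image {A : Finset G.edgeSet | IsSpanningTree A}
    (totalLength w) (Set.toFinite _) ⟨A₀, h₀⟩
  exact ⟨A, hA, hmin⟩

theorem IsMinSpanningTree.totalLength_eq {w : G.edgeSet → ℝ} {A : Finset G.edgeSet}
    (hA : IsMinSpanningTree w A) : totalLength w A = mstLength G w := by
  have : Nonempty {A : Finset G.edgeSet // IsSpanningTree A} := ⟨⟨A, hA.1⟩⟩
  refine le_antisymm (le_ciInf fun B => hA.2 B.1 B.2) ?_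
  exact ciInf_le (f := fun B : {B : Finset G.edgeSet // IsSpanningTree B} => totalLength w B.1)
    ⟨totalLength w A, by rintro _ ⟨B, rfl⟩; exact hA.2 B.1 B.2⟩ ⟨A, hA.1⟩

/-- The complete bipartite graph `K_{3,2}`. -/
abbrev K32 : SimpleGraph (Fin 3 ⊕ Fin 2) := completeBipartiteGraph (Fin 3) (Fin 2)

instance : DecidableRel K32.Adj := fun v w =>
  inferInstanceAs (Decidable (v.isLeft ∧ w.isRight ∨ v.isRight ∧ w.isLeft))

end SpanningTrees

end

/-! The graph has only 64 edge sets, so everything combinatorial reduces to a finite check once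
ranks are computable. Two vertices of the part of size 2 are connected exactly when they coincide or
have a common neighbour; this gives an explicit representative of each component (`componentRep`),
hence the rank (`rank_map`), and enumeration yields the Tutte polynomial and Steele's integrand.

Steele's formula itself is not used: the expectation is computed directly and agrees with the
integral because both equal 51/35. In a spanning tree exactly one vertex of the part of size 3 has
degree 2 and the other two are leaves. Hence the minimal length is the sum over these vertices of
the smaller incident edge, plus the smallest of the three larger incident edges (`mstLength_K32`).
Each minimum of two uniform variables has mean 1/3, and the minimum of the three maxima exceeds t
with probability (1 - t²)³, so the expectation is 3 · 1/3 + 16/35. -/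

namespace SpanningTrees

/-! ### Components and rank of subgraphs of K_{3,2} -/

/-- The edge of `K32` joining the vertices `i` and `j` of the two parts. -/
noncomputable def edgeEquiv : Fin 3 × Fin 2 ≃ K32.edgeSet :=
  Equiv.ofBijective (fun p => ⟨s(Sum.inl p.1, Sum.inr p.2), by simp⟩) <| by
    constructor
    · rintro ⟨i, j⟩ ⟨k, l⟩ h
      simpa using h
    · rintro ⟨z, hz⟩
      induction z with
      | _ x y =>
        rcases x with i | i <;> rcases y with j | j
        · simp at hz
        · exact ⟨(i, j), rfl⟩
        · exact ⟨(j, i), Subtype.ext Sym2.eq_swap⟩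
        · simp at hz

/-- A vertex that represents the component of a vertex in the subgraph with edges `B`. -/
def componentRep (B : Finset (Fin 3 × Fin 2)) : Fin 3 ⊕ Fin 2 → Fin 3 ⊕ Fin 2 :=
  let c : Fin 2 → Fin 3 ⊕ Fin 2 := fun j =>
    if ∃ i, (i, 0) ∈ B ∧ (i, 1) ∈ B then Sum.inr 0 else Sum.inr j
  Sum.elim (fun i => if (i, 0) ∈ B then c 0 else if (i, 1) ∈ B then c 1 else Sum.inl i) c

/-- The rank of the subgraph with edges `B`. -/
def edgeRank (B : Finset (Fin 3 × Fin 2)) : ℕ :=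
  5 - (Finset.univ.image (componentRep B)).card

theorem spanningSubgraph_adj (B : Finset (Fin 3 × Fin 2)) (i : Fin 3) (j : Fin 2) :
    (spanningSubgraph (B.map edgeEquiv.toEmbedding)).Adj (Sum.inl i) (Sum.inr j) ↔ (i, j) ∈ B := by
  rw [spanningSubgraph, SimpleGraph.fromEdgeSet_adj]
  constructor
  · rintro ⟨⟨e, he, hij⟩, -⟩
    have : e = edgeEquiv (i, j) := Subtype.ext hij
    simpa [this] using he
  · intro hB
    exact ⟨⟨edgeEquiv (i, j), by simpa using hB, rfl⟩, by simp⟩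

theorem componentRep_eq_of_mem :
    ∀ (B : Finset (Fin 3 × Fin 2)) (i : Fin 3) (j : Fin 2), (i, j) ∈ B →
      componentRep B (Sum.inl i) = componentRep B (Sum.inr j) := by
  decide +kernel

theorem componentRep_eq_of_adj (B : Finset (Fin 3 × Fin 2)) {x y : Fin 3 ⊕ Fin 2}
    (h : (spanningSubgraph (B.map edgeEquiv.toEmbedding)).Adj x y) :
    componentRep B x = componentRep B y := by
  have hK : K32.Adj x y := by
    have h' := h
    rw [spanningSubgraph, SimpleGraph.fromEdgeSet_adj] at h'
    obtain ⟨⟨e, -, he⟩, -⟩ := h'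
    have := e.2
    rwa [he] at this
  rcases x with i | i <;> rcases y with j | j
  · simp at hK
  · exact componentRep_eq_of_mem B i j ((spanningSubgraph_adj B i j).1 h)
  · exact (componentRep_eq_of_mem B j i ((spanningSubgraph_adj B j i).1 h.symm)).symm
  · simp at hK

/-- Together with constancy of `componentRep` along edges, this makes its values correspond
bijectively to the components. -/
theorem reachable_componentRep (B : Finset (Fin 3 × Fin 2)) (x : Fin 3 ⊕ Fin 2) :
    (spanningSubgraph (B.map edgeEquiv.toEmbedding)).Reachable x (componentRep B x) := by
  have hadj := fun i j h => ((spanningSubgraph_adj B i j).2 h).reachable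
  have hr : ∀ j : Fin 2, (spanningSubgraph (B.map edgeEquiv.toEmbedding)).Reachable
      (Sum.inr j) (componentRep B (Sum.inr j)) := by
    intro j
    by_cases h : ∃ i, (i, 0) ∈ B ∧ (i, 1) ∈ B
    · have : componentRep B (Sum.inr j) = Sum.inr 0 := by simp only [componentRep, Sum.elim_inr, if_pos h]
      rw [this]
      -- A common neighbour i gives the path from vertex 1 through i to vertex 0.
      obtain ⟨i, h0, h1⟩ := h
      fin_cases j
      · exact .refl _
      · exact (hadj i 1 h1).symm.trans (hadj i 0 h0)
    · have : componentRep B (Sum.inr j) = Sum.inr j := by simp only [componentRep, Sum.elim_inr, if_neg h]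
      rw [this]
  rcases x with i | j
  · by_cases h0 : (i, 0) ∈ B
    · rw [componentRep_eq_of_mem B i 0 h0]
      exact (hadj i 0 h0).trans (hr 0)
    · by_cases h1 : (i, 1) ∈ B
      · rw [componentRep_eq_of_mem B i 1 h1]
        exact (hadj i 1 h1).trans (hr 1)
      · have : componentRep B (Sum.inl i) = Sum.inl i := by simp [componentRep, h0, h1]
        rw [this]
  · exact hr j

theorem numComponents_map (B : Finset (Fin 3 × Fin 2)) :
    numComponents (spanningSubgraph (B.map edgeEquiv.toEmbedding)) =
      (Finset.univ.image (componentRep B)).card := by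
  set H := spanningSubgraph (B.map edgeEquiv.toEmbedding) with hH
  have hreach : ∀ {x y}, H.Reachable x y → componentRep B x = componentRep B y := by
    rintro x y ⟨p⟩
    induction p with
    | nil => rfl
    | cons h _ ih => exact (componentRep_eq_of_adj B h).trans ih
  let f : H.ConnectedComponent → Finset.univ.image (componentRep B) :=
    SimpleGraph.ConnectedComponent.lift
      (fun x => ⟨componentRep B x, Finset.mem_image_of_mem _ (Finset.mem_univ x)⟩)
      fun _ _ p _ => Subtype.ext (hreach ⟨p⟩)
  have hf : Function.Bijective f := by
    constructor
    · intro c d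
      induction c using SimpleGraph.ConnectedComponent.ind with | _ x
      induction d using SimpleGraph.ConnectedComponent.ind with | _ y
      intro h
      have h' : componentRep B x = componentRep B y := congrArg Subtype.val h
      rw [SimpleGraph.ConnectedComponent.eq]
      exact (reachable_componentRep B x).trans (h' ▸ (reachable_componentRep B y).symm)
    · rintro ⟨z, hz⟩
      obtain ⟨x, -, rfl⟩ := Finset.mem_image.1 hz
      exact ⟨H.connectedComponentMk x, rfl⟩
  rw [numComponents, Nat.card_eq_of_bijective f hf, Nat.card_eq_fintype_card, Fintype.card_coe]

theorem rank_map (B : Finset (Fin 3 × Fin 2)) :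
    rank (spanningSubgraph (B.map edgeEquiv.toEmbedding)) = edgeRank B := by
  rw [rank, numComponents_map, edgeRank]
  simp

theorem spanningSubgraph_univ : spanningSubgraph (Finset.univ.map edgeEquiv.toEmbedding) = K32 := by
  rw [Finset.map_univ_equiv, spanningSubgraph]
  simp

/-! ### Tutte polynomial and Steele's integrand -/

theorem rank_K32 : rank K32 = 4 := by
  rw [← spanningSubgraph_univ, rank_map]
  decide +kernel

/-- Edge sets are tallied by corank and nullity. The pair (0, 0) counts the 12 spanning trees and
(1, 1) the three 4-cycles. Working with a multiset of exponents leaves a statement about natural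
numbers that the kernel can decide. -/
theorem tutteExponents :
    (Finset.univ : Finset (Finset (Fin 3 × Fin 2))).val.map
        (fun B => (4 - edgeRank B, B.card - edgeRank B)) =
      Multiset.replicate 1 (4, 0) + Multiset.replicate 6 (3, 0) + Multiset.replicate 15 (2, 0) +
      Multiset.replicate 20 (1, 0) + Multiset.replicate 12 (0, 0) + Multiset.replicate 3 (1, 1) +
      Multiset.replicate 6 (0, 1) + Multiset.replicate 1 (0, 2) := by
  decide +kernel

theorem tuttePolynomial_K32 [Fintype K32.edgeSet] :
    tuttePolynomial K32 =
      (MvPolynomial.X 0 - 1) ^ 4 + 6 * (MvPolynomial.X 0 - 1) ^ 3 +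
      15 * (MvPolynomial.X 0 - 1) ^ 2 + 20 * (MvPolynomial.X 0 - 1) + 12 +
      3 * ((MvPolynomial.X 0 - 1) * (MvPolynomial.X 1 - 1)) + 6 * (MvPolynomial.X 1 - 1) +
      (MvPolynomial.X 1 - 1) ^ 2 := by
  have h : tuttePolynomial K32 = (((Finset.univ : Finset (Finset (Fin 3 × Fin 2))).val.map
      (fun B => (4 - edgeRank B, B.card - edgeRank B))).map (fun p : ℕ × ℕ =>
        (MvPolynomial.X 0 - 1 : MvPolynomial (Fin 2) ℝ) ^ p.1 * (MvPolynomial.X 1 - 1) ^ p.2)).sum := by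
    rw [Multiset.map_map]
    refine (Fintype.sum_equiv (Equiv.finsetCongr edgeEquiv) _ _ fun B => ?_).symm
    simp [rank_K32, rank_map]
  rw [h, tutteExponents]
  simp only [Multiset.map_add, Multiset.map_replicate, Multiset.sum_add, Multiset.sum_replicate,
    nsmul_eq_mul]
  push_cast
  ring

theorem tutteEval_K32 [Fintype K32.edgeSet] (x y : ℝ) :
    tutteEval K32 x y = (x - 1) ^ 4 + 6 * (x - 1) ^ 3 + 15 * (x - 1) ^ 2 + 20 * (x - 1) + 12 +
      3 * ((x - 1) * (y - 1)) + 6 * (y - 1) + (y - 1) ^ 2 := by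
  simp [tutteEval, tuttePolynomial_K32]

theorem tutteDxEval_K32 [Fintype K32.edgeSet] (x y : ℝ) :
    tutteDxEval K32 x y =
      4 * (x - 1) ^ 3 + 18 * (x - 1) ^ 2 + 30 * (x - 1) + 20 + 3 * (y - 1) := by
  have hn : ∀ n : ℕ, [n.AtLeastTwo] →
      MvPolynomial.pderiv 0 (OfNat.ofNat n : MvPolynomial (Fin 2) ℝ) = 0 := fun n _ => by
    rw [← Nat.cast_ofNat (R := MvPolynomial (Fin 2) ℝ)]; exact Derivation.map_natCast _ _
  simp [tutteDxEval, tuttePolynomial_K32, hn, Derivation.leibniz, Derivation.leibniz_pow,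
    MvPolynomial.pderiv_X]
  ring

/-- The point lies on the hyperbola (x - 1)(y - 1) = 1, where the term of A depends only on |A|:
with u = (1 - t)/t the sum is u⁴(1 + 1/u)⁶. Here the closed form is checked on the explicit
polynomial. -/
theorem tutteEval_K32_steele [Fintype K32.edgeSet] {t : ℝ} (ht : t ∈ Set.Ioo (0 : ℝ) 1) :
    tutteEval K32 (1 / t) (1 / (1 - t)) = 1 / (t ^ 4 * (1 - t) ^ 2) := by
  have h0 : t ≠ 0 := ht.1.ne'
  have h1 : 1 - t ≠ 0 := (sub_pos.2 ht.2).ne'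
  rw [tutteEval_K32]
  field_simp
  ring

theorem steeleIntegrand_K32 [Fintype K32.edgeSet] {t : ℝ} (ht : t ∈ Set.Ioo (0 : ℝ) 1) :
    steeleIntegrand K32 t = 4 - 6 * t + 3 * t ^ 4 - t ^ 6 := by
  have h0 : t ≠ 0 := ht.1.ne'
  have h1 : 1 - t ≠ 0 := (sub_pos.2 ht.2).ne'
  rw [steeleIntegrand, tutteEval_K32_steele ht, tutteDxEval_K32]
  field_simp
  ring

theorem steeleIntegrand_K32_eq_eval_iff [Fintype K32.edgeSet] (p : Polynomial ℝ) :
    (∀ t ∈ Set.Ioo (0 : ℝ) 1, steeleIntegrand K32 t = p.eval t) ↔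
      p = 4 - 6 * Polynomial.X + 3 * Polynomial.X ^ 4 - Polynomial.X ^ 6 := by
  constructor
  · intro h
    -- Uniqueness: polynomials that agree on an infinite set are equal.
    refine Polynomial.eq_of_infinite_eval_eq _ _ ((Set.Ioo_infinite zero_lt_one).mono fun t ht => ?_)
    change p.eval t = _
    rw [← h t ht, steeleIntegrand_K32 ht]
    simp
  · rintro rfl t ht
    rw [steeleIntegrand_K32 ht]
    simp

/-! ### Spanning trees and the minimal length -/

/-- The edges at the vertices `k` of the part of size `3`: both of them for `k = i`, and only the
edge to `c k` otherwise. -/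
def treeEdges (i : Fin 3) (c : Fin 3 → Fin 2) : Finset (Fin 3 × Fin 2) :=
  Finset.univ.filter fun p => p.1 = i ∨ p.2 = c p.1

/-- Connectedness forces degree 1 or 2 at each of the three vertices, and the degrees sum to 4, so
exactly one is 2. The value c i has no effect on the edge set, so each tree is described twice,
which is harmless. -/
theorem card_image_componentRep_eq_one_and_card_eq_four_iff :
    ∀ B : Finset (Fin 3 × Fin 2), ((Finset.univ.image (componentRep B)).card = 1 ∧ B.card = 4) ↔
      ∃ i c, B = treeEdges i c := by
  decide +kernel

theorem edgeSet_spanningSubgraph {V : Type*} {G : SimpleGraph V} (A : Finset G.edgeSet) :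
    (spanningSubgraph A).edgeSet = Subtype.val '' (A : Set G.edgeSet) := by
  rw [spanningSubgraph, SimpleGraph.edgeSet_fromEdgeSet, sdiff_eq_left, Set.disjoint_left]
  rintro _ ⟨e, -, rfl⟩
  exact G.not_isDiag_of_mem_edgeSet e.2

theorem connected_iff_numComponents_eq_one {V : Type*} [Finite V] (H : SimpleGraph V) :
    H.Connected ↔ numComponents H = 1 := by
  rw [numComponents, Nat.card_eq_one_iff_unique, SimpleGraph.connected_iff]
  constructor
  · rintro ⟨h, hV⟩
    exact ⟨h.subsingleton_connectedComponent, hV.map H.connectedComponentMk⟩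
  · rintro ⟨h, ⟨c⟩⟩
    exact ⟨fun x y => SimpleGraph.ConnectedComponent.exact (h.elim _ _), c.nonempty_supp.nonempty⟩

theorem isSpanningTree_map_iff (B : Finset (Fin 3 × Fin 2)) :
    IsSpanningTree (B.map edgeEquiv.toEmbedding) ↔ ∃ i c, B = treeEdges i c := by
  rw [← card_image_componentRep_eq_one_and_card_eq_four_iff, IsSpanningTree,
    SimpleGraph.isTree_iff_connected_and_card, connected_iff_numComponents_eq_one,
    numComponents_map, edgeSet_spanningSubgraph, Nat.card_image_of_injective Subtype.val_injective,
    Nat.card_coe_set_eq, Set.ncard_coe_finset, Finset.card_map]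
  simp

theorem isSpanningTree_iff (A : Finset K32.edgeSet) :
    IsSpanningTree A ↔ ∃ i c, A = (treeEdges i c).map edgeEquiv.toEmbedding := by
  obtain ⟨B, rfl⟩ := (Equiv.finsetCongr edgeEquiv).surjective A
  simp [isSpanningTree_map_iff]

theorem apply_add_apply_add_one (v : Fin 2 → ℝ) (j : Fin 2) : v j + v (j + 1) = v 0 + v 1 := by
  fin_cases j
  · rfl
  · exact add_comm _ _

/-- In `Fin 2`, adding 1 swaps the two vertices, so the last term is the second edge at i. -/
theorem totalLength_treeEdges (w : K32.edgeSet → ℝ) (i : Fin 3) (c : Fin 3 → Fin 2) :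
    totalLength w ((treeEdges i c).map edgeEquiv.toEmbedding) =
      ∑ k, w (edgeEquiv (k, c k)) + w (edgeEquiv (i, c i + 1)) := by
  rw [totalLength, Finset.sum_map, treeEdges, Finset.sum_filter, Fintype.sum_prod_type]
  have h : ∀ k : Fin 3, ∑ j : Fin 2,
      (if k = i ∨ j = c k then w (edgeEquiv (k, j)) else 0) =
        w (edgeEquiv (k, c k)) + if k = i then w (edgeEquiv (k, c k + 1)) else 0 := by
    intro k
    by_cases hk : k = i
    · simp only [hk, true_or, if_true, Fin.sum_univ_two]
      exact (apply_add_apply_add_one (fun j => w (edgeEquiv (i, j))) (c i)).symm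
    · simp [hk]
  simp only [Equiv.coe_toEmbedding, h, Finset.sum_add_distrib, Finset.sum_ite_eq', Finset.mem_univ,
    if_true]

/-- A tree uses both edges at one vertex, with total min + max, and a single edge, at least the min,
at each other vertex. Equality is attained by choosing the shorter edge everywhere and doubling at
the vertex whose longer edge is smallest. -/
theorem mstLength_K32 (w : K32.edgeSet → ℝ) :
    mstLength K32 w =
      ∑ k, min (w (edgeEquiv (k, 0))) (w (edgeEquiv (k, 1))) +
        Finset.univ.inf' Finset.univ_nonempty
          fun k => max (w (edgeEquiv (k, 0))) (w (edgeEquiv (k, 1))) := by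
  set M : Fin 3 → ℝ := fun k => max (w (edgeEquiv (k, 0))) (w (edgeEquiv (k, 1)))
  have hadd : ∀ k (j : Fin 2), w (edgeEquiv (k, j)) + w (edgeEquiv (k, j + 1)) =
      min (w (edgeEquiv (k, 0))) (w (edgeEquiv (k, 1))) + M k := by
    intro k j
    rw [min_add_max]
    exact apply_add_apply_add_one (fun j => w (edgeEquiv (k, j))) j
  have hmin : ∀ k (j : Fin 2),
      min (w (edgeEquiv (k, 0))) (w (edgeEquiv (k, 1))) ≤ w (edgeEquiv (k, j)) := by
    intro k j
    fin_cases j <;> simp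
  obtain ⟨i, -, hi⟩ := Finset.exists_mem_eq_inf' Finset.univ_nonempty M
  have hc : ∀ k, ∃ j : Fin 2,
      w (edgeEquiv (k, j)) = min (w (edgeEquiv (k, 0))) (w (edgeEquiv (k, 1))) := by
    intro k
    rcases min_choice (w (edgeEquiv (k, 0))) (w (edgeEquiv (k, 1))) with h | h
    · exact ⟨0, h.symm⟩
    · exact ⟨1, h.symm⟩
  choose c hc using hc
  have hT : IsMinSpanningTree w ((treeEdges i c).map edgeEquiv.toEmbedding) := by
    refine ⟨(isSpanningTree_iff _).2 ⟨i, c, rfl⟩, fun B hB => ?_⟩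
    obtain ⟨l, d, rfl⟩ := (isSpanningTree_iff _).1 hB
    rw [totalLength_treeEdges, totalLength_treeEdges]
    have hM : M i ≤ M l := hi ▸ Finset.inf'_le M (Finset.mem_univ l)
    -- The competing tree has its degree-2 vertex at l: there `hadd` gives min + M l exactly, so
    -- only the other vertices need an estimate.
    have hrest : ∑ k ∈ Finset.univ.erase l, min (w (edgeEquiv (k, 0))) (w (edgeEquiv (k, 1))) ≤
        ∑ k ∈ Finset.univ.erase l, w (edgeEquiv (k, d k)) :=
      Finset.sum_le_sum fun k _ => hmin k (d k)
    have hs := Finset.sum_erase_add Finset.univ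
      (fun k => min (w (edgeEquiv (k, 0))) (w (edgeEquiv (k, 1)))) (Finset.mem_univ l)
    have hs' := Finset.sum_erase_add Finset.univ
      (fun k => w (edgeEquiv (k, d k))) (Finset.mem_univ l)
    have h1 := hadd l (d l)
    have h2 := hadd i (c i)
    have h3 := hc i
    simp only [hc]
    linarith
  rw [← hT.totalLength_eq, totalLength_treeEdges, hi]
  have h2 := hadd i (c i)
  have h3 := hc i
  simp only [hc]
  linarith

/-- The monomials are those of Steele's polynomial and of (1 - t²)³ combined, so one evaluation
serves both integrals. -/
theorem intervalIntegral_polynomial (a b c d e : ℝ) :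
    ∫ t in (0 : ℝ)..1, (a + b * t + c * t ^ 2 + d * t ^ 4 + e * t ^ 6) =
      a + b / 2 + c / 3 + d / 5 + e / 7 := by
  have hi : ∀ {f : ℝ → ℝ}, Continuous f → IntervalIntegrable f volume 0 1 :=
    fun hf => hf.intervalIntegrable 0 1
  rw [intervalIntegral.integral_add (hi (by fun_prop)) (hi (by fun_prop)),
    intervalIntegral.integral_add (hi (by fun_prop)) (hi (by fun_prop)),
    intervalIntegral.integral_add (hi (by fun_prop)) (hi (by fun_prop)),
    intervalIntegral.integral_add (hi (by fun_prop)) (hi (by fun_prop))]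
  rw [intervalIntegral.integral_const_mul b fun t => t, integral_id]
  simp only [intervalIntegral.integral_const_mul, intervalIntegral.integral_const, integral_pow,
    smul_eq_mul]
  norm_num
  ring

/-! ### Expectations of the minima and maxima of uniform variables -/

section Probability

variable {Ω : Type*} [MeasurableSpace Ω] {P : Measure Ω}

/-- The layer-cake formula; the tail vanishes beyond 1 since X ≤ 1 almost surely. -/
theorem integral_eq_intervalIntegral_meas_lt {X : Ω → ℝ} (hX : Integrable X P)
    (h0 : ∀ᵐ ω ∂P, 0 ≤ X ω) (h1 : ∀ᵐ ω ∂P, X ω ≤ 1) :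
    ∫ ω, X ω ∂P = ∫ t in (0 : ℝ)..1, P.real {ω | t < X ω} := by
  rw [hX.integral_eq_integral_meas_lt h0, intervalIntegral.integral_of_le zero_le_one]
  refine setIntegral_eq_of_subset_of_forall_sdiff_eq_zero measurableSet_Ioi
    Set.Ioc_subset_Ioi_self fun t ht => ?_
  have ht1 : 1 < t := by
    by_contra h
    exact ht.2 ⟨ht.1, not_lt.1 h⟩
  have : P {ω | t < X ω} = 0 :=
    measure_mono_null (fun ω (hω : t < X ω) => (ht1.trans hω).not_ge) h1
  simp [measureReal_def, this]

theorem isUniform_measureReal_le {X : Ω → ℝ} (hX : pdf.IsUniform X (Set.Icc (0 : ℝ) 1) P volume)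
    {t : ℝ} (ht : t ∈ Set.Icc (0 : ℝ) 1) : P.real {ω | X ω ≤ t} = t := by
  have h := hX.measure_preimage (by simp) (by simp) (measurableSet_Iic (a := t))
  have hI : Set.Icc (0 : ℝ) 1 ∩ Set.Iic t = Set.Icc 0 t := by
    ext x
    simp only [Set.mem_inter_iff, Set.mem_Icc, Set.mem_Iic]
    exact ⟨fun h => ⟨h.1.1, h.2⟩, fun h => ⟨⟨h.1, h.2.trans ht.2⟩, h.2⟩⟩
  rw [hI] at h
  change P {ω | X ω ≤ t} = _ at h
  simp [measureReal_def, h, ht.1]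

theorem isUniform_ae_mem {X : Ω → ℝ} (hX : pdf.IsUniform X (Set.Icc (0 : ℝ) 1) P volume) :
    ∀ᵐ ω ∂P, X ω ∈ Set.Icc (0 : ℝ) 1 := by
  have h := hX.measure_preimage (by simp) (by simp) (measurableSet_Icc (a := (0 : ℝ)) (b := 1)).compl
  rw [Set.inter_compl_self, measure_empty, ENNReal.zero_div] at h
  exact h

variable [IsProbabilityMeasure P]

/-- The probability that, for every `i`, the maximum of the variables `X (i, j)` exceeds `t`. -/
theorem measureReal_forall_exists_lt {ι κ : Type*} [Fintype ι] [Fintype κ]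
    {X : ι × κ → Ω → ℝ} (hm : ∀ p, Measurable (X p)) (hX : iIndepFun X P) {t : ℝ}
    (ht : ∀ p, P.real {ω | X p ω ≤ t} = t) :
    P.real {ω | ∀ i, ∃ j, t < X (i, j) ω} = (1 - t ^ Fintype.card κ) ^ Fintype.card ι := by
  classical
  let F : ι → Set Ω := fun i => ⋂ j, {ω | X (i, j) ω ≤ t}
  have hle : ∀ p, MeasurableSet {ω | X p ω ≤ t} := fun p => hm p measurableSet_Iic
  have hFm : ∀ i, MeasurableSet (F i) := fun i => MeasurableSet.iInter fun j => hle (i, j)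
  -- The intersection is a joint event for the variables indexed by s × κ. This one product formula
  -- gives both the independence of the F i and, for s = {i}, their probabilities.
  have hprod : ∀ s : Finset ι, P (⋂ i ∈ s, F i) =
      ∏ i ∈ s, ∏ j, P {ω | X (i, j) ω ≤ t} := by
    intro s
    rw [← Finset.prod_product s Finset.univ fun p => P {ω | X p ω ≤ t},
      ← hX.meas_biInter (s := fun p => {ω | X p ω ≤ t})
        fun p _ => ⟨Set.Iic t, measurableSet_Iic, rfl⟩]
    congr 1
    ext ω
    simp only [F, Set.mem_iInter, Finset.mem_product, Finset.mem_univ, and_true, Prod.forall]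
    exact ⟨fun h i j hi => h i hi j, fun h i hi j => h i j hi⟩
  have hF : iIndepSet F P := by
    rw [iIndepSet_iff_meas_biInter hFm]
    intro s
    rw [hprod]
    refine Finset.prod_congr rfl fun i _ => ?_
    simpa using (hprod {i}).symm
  have hFi : ∀ i, P.real (F i) = t ^ Fintype.card κ := by
    intro i
    have := hprod {i}
    simp only [Finset.mem_singleton, Set.iInter_iInter_eq_left, Finset.prod_singleton] at this
    rw [measureReal_def, this, ENNReal.toReal_prod]
    simp only [← measureReal_def, ht, Finset.prod_const, Finset.card_univ]
  have hset : {ω | ∀ i, ∃ j, t < X (i, j) ω} = ⋂ i, (F i)ᶜ := by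
    ext ω
    simp [F]
  -- Independence of events unfolds to independence of the generated σ-algebras, which also contain
  -- the complements.
  have hind : iIndep (fun i => MeasurableSpace.generateFrom {F i}) P := hF
  rw [hset, measureReal_def, hind.meas_iInter fun i =>
    (MeasurableSpace.measurableSet_generateFrom (Set.mem_singleton (F i))).compl,
    ENNReal.toReal_prod]
  simp only [← measureReal_def, probReal_compl_eq_one_sub (hFm _), hFi, Finset.prod_const,
    Finset.card_univ]

/-- The minimum exceeds t exactly when both variables do, with probability (1 - t)². -/
theorem integral_min {X Y : Ω → ℝ} (hXY : IndepFun X Y P) (hXm : Measurable X) (hYm : Measurable Y)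
    (hX : pdf.IsUniform X (Set.Icc (0 : ℝ) 1) P volume)
    (hY : pdf.IsUniform Y (Set.Icc (0 : ℝ) 1) P volume) :
    Integrable (fun ω => min (X ω) (Y ω)) P ∧ ∫ ω, min (X ω) (Y ω) ∂P = 1 / 3 := by
  have h0 : ∀ᵐ ω ∂P, 0 ≤ min (X ω) (Y ω) := by
    filter_upwards [isUniform_ae_mem hX, isUniform_ae_mem hY] with ω h h' using le_min h.1 h'.1
  have h1 : ∀ᵐ ω ∂P, min (X ω) (Y ω) ≤ 1 := by
    filter_upwards [isUniform_ae_mem hX] with ω h using (min_le_left _ _).trans h.2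
  have hI : Integrable (fun ω => min (X ω) (Y ω)) P := by
    refine Integrable.of_bound (hXm.min hYm).aestronglyMeasurable 1 ?_
    filter_upwards [h0, h1] with ω h h' using by rwa [Real.norm_of_nonneg h]
  refine ⟨hI, ?_⟩
  have hgt : ∀ {Z : Ω → ℝ}, Measurable Z → pdf.IsUniform Z (Set.Icc (0 : ℝ) 1) P volume →
      ∀ t ∈ Set.Icc (0 : ℝ) 1, P.real (Z ⁻¹' Set.Ioi t) = 1 - t := by
    intro Z hZm hZ t ht
    have h := probReal_compl_eq_one_sub (μ := P) (hZm (measurableSet_Iic (a := t)))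
    rw [← Set.preimage_compl, Set.compl_Iic] at h
    rw [h]
    exact congrArg _ (isUniform_measureReal_le hZ ht)
  rw [integral_eq_intervalIntegral_meas_lt hI h0 h1]
  have hcongr : ∀ t ∈ Set.uIcc (0 : ℝ) 1, P.real {ω | t < min (X ω) (Y ω)} = (1 - t) ^ 2 := by
    intro t ht
    rw [Set.uIcc_of_le zero_le_one] at ht
    have hset : {ω | t < min (X ω) (Y ω)} = X ⁻¹' Set.Ioi t ∩ Y ⁻¹' Set.Ioi t := by
      ext ω
      simp
    rw [hset, measureReal_def, hXY.measure_inter_preimage_eq_mul _ _ measurableSet_Ioi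
      measurableSet_Ioi, ENNReal.toReal_mul, ← measureReal_def, ← measureReal_def,
      hgt hXm hX t ht, hgt hYm hY t ht, sq]
  rw [intervalIntegral.integral_congr hcongr]
  simp only [intervalIntegral.integral_comp_sub_left fun x : ℝ => x ^ 2]
  norm_num [integral_pow]

/-- The minimum of the maxima exceeds t exactly when every k has some j with X (k, j) > t;
integrating the probability of this event gives the mean. -/
theorem integral_inf'_max {X : Fin 3 × Fin 2 → Ω → ℝ} (hm : ∀ p, Measurable (X p))
    (hX : iIndepFun X P) (hU : ∀ p, pdf.IsUniform (X p) (Set.Icc (0 : ℝ) 1) P volume) :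
    Integrable (fun ω => Finset.univ.inf' Finset.univ_nonempty
      fun k => max (X (k, 0) ω) (X (k, 1) ω)) P ∧
    ∫ ω, (Finset.univ.inf' Finset.univ_nonempty fun k => max (X (k, 0) ω) (X (k, 1) ω)) ∂P =
      ∫ t in (0 : ℝ)..1, (1 - t ^ 2) ^ 3 := by
  have hmem : ∀ᵐ ω ∂P, ∀ p, X p ω ∈ Set.Icc (0 : ℝ) 1 :=
    ae_all_iff.2 fun p => isUniform_ae_mem (hU p)
  have h0 : ∀ᵐ ω ∂P, 0 ≤ Finset.univ.inf' Finset.univ_nonempty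
      fun k => max (X (k, 0) ω) (X (k, 1) ω) := by
    filter_upwards [hmem] with ω h
    exact Finset.le_inf' _ _ fun k _ => (h (k, 0)).1.trans (le_max_left _ _)
  have h1 : ∀ᵐ ω ∂P, (Finset.univ.inf' Finset.univ_nonempty
      fun k => max (X (k, 0) ω) (X (k, 1) ω)) ≤ 1 := by
    filter_upwards [hmem] with ω h
    exact (Finset.inf'_le _ (Finset.mem_univ 0)).trans (max_le (h _).2 (h _).2)
  have hmeas : Measurable fun ω => Finset.univ.inf' Finset.univ_nonempty
      fun k => max (X (k, 0) ω) (X (k, 1) ω) := by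
    have := Finset.inf'_induction Finset.univ_nonempty
      (fun (k : Fin 3) ω => max (X (k, 0) ω) (X (k, 1) ω)) (p := Measurable)
      (fun _ hf _ hg => hf.inf hg) fun k _ => (hm (k, 0)).max (hm (k, 1))
    convert this using 2
    rw [Finset.inf'_apply]
  have hI : Integrable (fun ω => Finset.univ.inf' Finset.univ_nonempty
      fun k => max (X (k, 0) ω) (X (k, 1) ω)) P := by
    refine Integrable.of_bound hmeas.aestronglyMeasurable 1 ?_
    filter_upwards [h0, h1] with ω h h' using by rwa [Real.norm_of_nonneg h]
  refine ⟨hI, ?_⟩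
  rw [integral_eq_intervalIntegral_meas_lt hI h0 h1]
  refine intervalIntegral.integral_congr fun t ht => ?_
  rw [Set.uIcc_of_le zero_le_one] at ht
  have h := measureReal_forall_exists_lt hm hX fun p => isUniform_measureReal_le (hU p) ht
  simpa [Fin.exists_fin_two] using h

theorem integral_mstLength_K32_of_measurable {ξ : K32.edgeSet → Ω → ℝ}
    (hm : ∀ e, Measurable (ξ e)) (hξ : iIndepFun ξ P)
    (hU : ∀ e, pdf.IsUniform (ξ e) (Set.Icc (0 : ℝ) 1) P volume) :
    Integrable (fun ω => mstLength K32 fun e => ξ e ω) P ∧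
      ∫ ω, mstLength K32 (fun e => ξ e ω) ∂P = 51 / 35 := by
  have hmin := fun k : Fin 3 => integral_min
    (hξ.indepFun (edgeEquiv.injective.ne (show (k, 0) ≠ (k, 1) by simp)))
    (hm _) (hm _) (hU (edgeEquiv (k, 0))) (hU (edgeEquiv (k, 1)))
  obtain ⟨hI, hint⟩ := integral_inf'_max (fun p => hm (edgeEquiv p))
    (hξ.precomp edgeEquiv.injective) fun p => hU (edgeEquiv p)
  have hsum := integrable_finsetSum Finset.univ fun k _ => (hmin k).1
  simp only [mstLength_K32]
  refine ⟨hsum.add hI, ?_⟩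
  rw [integral_add hsum hI, hint, integral_finsetSum _ fun k _ => (hmin k).1]
  simp only [(hmin _).2]
  have hpoly : ∀ t : ℝ, (1 - t ^ 2) ^ 3 = 1 + 0 * t + -3 * t ^ 2 + 3 * t ^ 4 + -1 * t ^ 6 :=
    fun t => by ring
  simp only [hpoly, intervalIntegral_polynomial]
  norm_num

/-- Uniformity of the law provides only almost-everywhere measurability. Passing to measurable
modifications preserves independence, the laws and the integral. -/
theorem integral_mstLength_K32 {ξ : K32.edgeSet → Ω → ℝ} (hξ : iIndepFun ξ P)
    (hU : ∀ e, pdf.IsUniform (ξ e) (Set.Icc (0 : ℝ) 1) P volume) :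
    Integrable (fun ω => mstLength K32 fun e => ξ e ω) P ∧
      ∫ ω, mstLength K32 (fun e => ξ e ω) ∂P = 51 / 35 := by
  have hae : ∀ e, AEMeasurable (ξ e) P := fun e => (hU e).aemeasurable (by simp) (by simp)
  have hmk : ∀ e, ξ e =ᵐ[P] (hae e).mk := fun e => (hae e).ae_eq_mk
  have h := integral_mstLength_K32_of_measurable (fun e => (hae e).measurable_mk)
    (hξ.congr hmk) fun e => by
      have := hU e
      rwa [pdf.IsUniform, Measure.map_congr (hmk e)] at this
  have heq : (fun ω => mstLength K32 fun e => ξ e ω) =ᵐ[P]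
      fun ω => mstLength K32 fun e => (hae e).mk (ξ e) ω := by
    filter_upwards [ae_all_iff.2 hmk] with ω hω
    simp only [hω]
  exact ⟨h.1.congr heq.symm, (integral_congr_ae heq).trans h.2⟩

end Probability

end SpanningTrees

theorem mainTheorem7 :
    -- on (0, 1) the denominator in Steele's integrand does not vanish
    (∀ t ∈ Set.Ioo (0 : ℝ) 1, SpanningTrees.tutteEval SpanningTrees.K32 (1 / t) (1 / (1 - t)) ≠ 0) ∧
    -- the polynomial that gives Steele's integrand on (0, 1) exists, is unique, and is the stated one
    (∀ p : Polynomial ℝ,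
      (∀ t ∈ Set.Ioo (0 : ℝ) 1, SpanningTrees.steeleIntegrand SpanningTrees.K32 t = p.eval t) ↔
        p = 4 - 6 * Polynomial.X + 3 * Polynomial.X ^ 4 - Polynomial.X ^ 6) ∧
    -- the expected length of the minimal spanning tree
    (∀ {Ω : Type*} [MeasurableSpace Ω] (P : Measure Ω) [IsProbabilityMeasure P]
      (ξ : SpanningTrees.K32.edgeSet → Ω → ℝ),
      iIndepFun ξ P →
      (∀ e, pdf.IsUniform (ξ e) (Set.Icc (0 : ℝ) 1) P volume) →
        Integrable (fun ω => SpanningTrees.mstLength SpanningTrees.K32 (fun e => ξ e ω)) P ∧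
        ∫ ω, SpanningTrees.mstLength SpanningTrees.K32 (fun e => ξ e ω) ∂P =
          ∫ t in (0 : ℝ)..1, (4 - 6 * t + 3 * t ^ 4 - t ^ 6) ∧
        ∫ ω, SpanningTrees.mstLength SpanningTrees.K32 (fun e => ξ e ω) ∂P = 51 / 35) := by
  refine ⟨fun t ht => ?_, SpanningTrees.steeleIntegrand_K32_eq_eval_iff, ?_⟩
  · rw [SpanningTrees.tutteEval_K32_steele ht]
    have h0 := ht.1
    have h1 := sub_pos.2 ht.2
    positivity
  · intro Ω _ P _ ξ hξ hU
    obtain ⟨hI, hint⟩ := SpanningTrees.integral_mstLength_K32 hξ hU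
    -- What remains is to evaluate Steele's integral: 4 - 3 + 3/5 - 1/7 = 51/35.
    refine ⟨hI, hint.trans ?_, hint⟩
    have hpoly : ∀ t : ℝ, 4 - 6 * t + 3 * t ^ 4 - t ^ 6 =
        4 + -6 * t + 0 * t ^ 2 + 3 * t ^ 4 + -1 * t ^ 6 := fun t => by ring
    simp only [hpoly, SpanningTrees.intervalIntegral_polynomial]
    norm_num
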